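/- Let $\mathcal H$ and $\mathcal K$ be complex Hilbert spaces, let $\mathcal L(\mathcal H)$, $\mathcal L(\mathcal K)$ be their algebras of bounded operators, and let $m\ge 1$. Identify $\mathbf C^{m\times m}\otimes\mathcal L(\mathcal H)$ with the $m\times m$ matrices over $\mathcal L(\mathcal H)$; call such a matrix positive if it is a positive (semidefinite) operator on $\mathcal H\oplus\dots\oplus\mathcal H$ ($m$ copies), and similarly for $\mathcal K$. Let $T,R,S_1,\dots,S_{m-1}\in\mathcal L(\mathcal H)$ and suppose that $A\in\mathbf C^{m\times m}\otimes\mathcal L(\mathcal H)$ is a positive matrix of the form \[ A=\begin{bmatrix} T & 0 & \cdots & 0 & S_1\\ 0 & T & \cdots & 0 & S_2\\ \vdots & \vdots & \ddots & \vdots & \vdots\\ 0 & 0 & \cdots & T & S_{m-1}\\ S_1 & S_2 & \cdots & S_{m-1} & R \end{bmatrix} \quad\text{or}\quad A=\begin{bmatrix} T & S_1 & S_2 & \cdots & S_{m-1}\\ S_1 & R & 0 & \cdots & 0\\ S_2 & 0 & R & \cdots & 0\\ \vdots & \vdots & \vdots & \ddots & \vdots\\ S_{m-1} & 0 & 0 &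 \cdots & R \end{bmatrix}. \] Then for every positive map $\Phi:\mathcal L(\mathcal H)\to\mathcal L(\mathcal K)$, i.e. every linear map such that $B\ge 0$ implies $\Phi(B)\ge 0$, the matrix $(I_m\otimes\Phi)(A)=(\Phi(A_{ij}))_{i,j}$ is positive. -/

import Mathlib

noncomputable section

/-- The bounded operator on the Hilbert space direct sum `H ⊕ ⋯ ⊕ H` (`m` copies, with its
`ℓ²`-norm and inner product) given by an `m × m` matrix `A` of bounded operators on `H`:
its `i`-th component at `x` is `∑ j, A i j (x j)`. -/
def blockOperator {m : ℕ} {H : Type*} [NormedAddCommGroup H] [InnerProductSpace ℂ H]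
    (A : Matrix (Fin m) (Fin m) (H →L[ℂ] H)) :
    PiLp 2 (fun _ : Fin m => H) →L[ℂ] PiLp 2 (fun _ : Fin m => H) :=
  ((PiLp.continuousLinearEquiv 2 ℂ (fun _ : Fin m => H)).symm :
      (Fin m → H) →L[ℂ] PiLp 2 (fun _ : Fin m => H)).comp
    (ContinuousLinearMap.pi fun i =>
      ∑ j, (A i j).comp (PiLp.proj 2 (fun _ : Fin m => H) j))

theorem blockOperator_apply {m : ℕ} {H : Type*} [NormedAddCommGroup H] [InnerProductSpace ℂ H]
    (A : Matrix (Fin m) (Fin m) (H →L[ℂ] H)) (x : PiLp 2 (fun _ : Fin m => H)) (i : Fin m) :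
    blockOperator A x i = ∑ j, A i j (x j) := by
  simp [blockOperator]

/-- A matrix of bounded operators on `H` is positive if it is a positive (semidefinite)
bounded operator on the direct sum `H ⊕ ⋯ ⊕ H`. -/
def BlockPositive {m : ℕ} {H : Type*} [NormedAddCommGroup H] [InnerProductSpace ℂ H]
    (A : Matrix (Fin m) (Fin m) (H →L[ℂ] H)) : Prop :=
  (blockOperator A).IsPositive

/-- The map `I_m ⊗ Φ`, under the usual identification of `ℂ^{m × m} ⊗ L(H)` with the `m × m`
matrices over `L(H)`: it applies `Φ` to each entry. -/
def ampliation (m : ℕ) {H K : Type*} [NormedAddCommGroup H] [InnerProductSpace ℂ H]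
    [NormedAddCommGroup K] [InnerProductSpace ℂ K]
    (Φ : (H →L[ℂ] H) →ₗ[ℂ] (K →L[ℂ] K)) :
    Matrix (Fin m) (Fin m) (H →L[ℂ] H) →ₗ[ℂ] Matrix (Fin m) (Fin m) (K →L[ℂ] K) :=
  Φ.mapMatrix

/-- The `(n + 1) × (n + 1)` matrix with diagonal `T, …, T, R`, with last column and last row
`S 0, …, S (n - 1), R`, and with all other entries `0`. -/
def arrowLast {n : ℕ} {L : Type*} [Zero L] (T R : L) (S : Fin n → L) :
    Matrix (Fin (n + 1)) (Fin (n + 1)) L :=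
  Matrix.of fun i j =>
    Fin.lastCases (motive := fun _ => L)
      (Fin.lastCases (motive := fun _ => L) R (fun j' => S j') j)
      (fun i' => Fin.lastCases (motive := fun _ => L) (S i')
        (fun j' => if i' = j' then T else 0) j) i

/-- The `(n + 1) × (n + 1)` matrix with diagonal `T, R, …, R`, with first column and first row
`T, S 0, …, S (n - 1)`, and with all other entries `0`. -/
def arrowFirst {n : ℕ} {L : Type*} [Zero L] (T R : L) (S : Fin n → L) :
    Matrix (Fin (n + 1)) (Fin (n + 1)) L :=
  Matrix.of fun i j =>
    Fin.cases (motive := fun _ => L)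
      (Fin.cases (motive := fun _ => L) T (fun j' => S j') j)
      (fun i' => Fin.cases (motive := fun _ => L) (S i')
        (fun j' => if i' = j' then R else 0) j) i

end

/-! Perturb `T` to an invertible `C * C` with `C` selfadjoint, and write `S i = C * X i * C`.
Completing the square shows that the Schur complement `R - ∑ C X_i² C` is positive. With `Ψ B = Φ (C
* B * C)`, the form of the image splits into the 2 × 2 forms with entries `Ψ 1, Ψ X_i, Ψ X_i²`, plus
the form of `Φ` of the Schur complement. The 2 × 2 forms are nonnegative by Kadison's inequality,
because `X i` is selfadjoint.

Kadison's inequality would follow from spectral projections, as `∑ Φ(E_λ) ⊗ [1 λ; λ λ²]`. Here the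
projections are replaced by Bernstein polynomials of `a`: positive operators with sum `1` and mean
`a`, whose second moment is `a²` up to an error of order `1 / N`. -/

section ArrowMatrices

open scoped InnerProductSpace ComplexOrder

/-! ### Kadison's inequality by Bernstein polynomials -/

open Polynomial in
/-- A real polynomial which is nonnegative on `[0, 1]` is positive at every `0 ≤ a ≤ 1`. -/
theorem aeval_isPositive_of_nonneg_on_unitInterval {H : Type*} [NormedAddCommGroup H]
    [InnerProductSpace ℂ H] [CompleteSpace H] {a : H →L[ℂ] H} (h0 : 0 ≤ a) (h1 : a ≤ 1)
    (p : ℝ[X]) (hp : ∀ t ∈ Set.Icc (0 : ℝ) 1, 0 ≤ p.eval t) : (aeval a p).IsPositive := by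
  have hsa : IsSelfAdjoint a := .of_nonneg h0
  rw [← ContinuousLinearMap.nonneg_iff_isPositive, ← cfc_polynomial p a hsa]
  refine cfc_nonneg fun t ht => hp t ⟨spectrum_nonneg_of_nonneg h0 ht, ?_⟩
  exact (le_algebraMap_iff_spectrum_le (r := (1 : ℝ)) (a := a)).1 (by simpa using h1) t ht

theorem bernsteinPolynomial_eval_nonneg (n k : ℕ) {t : ℝ} (ht : t ∈ Set.Icc (0 : ℝ) 1) :
    0 ≤ (bernsteinPolynomial ℝ n k).eval t := by
  have h0 : 0 ≤ t := ht.1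
  have h1 : 0 ≤ 1 - t := sub_nonneg.2 ht.2
  simp only [bernsteinPolynomial, Polynomial.eval_mul, Polynomial.eval_pow, Polynomial.eval_sub,
    Polynomial.eval_X, Polynomial.eval_one, Polynomial.eval_natCast]
  positivity

variable {H K : Type*} [NormedAddCommGroup H] [InnerProductSpace ℂ H]
  [NormedAddCommGroup K] [InnerProductSpace ℂ K]

/-- The linear functional `B ↦ ⟪z, Φ B w⟫`. -/
noncomputable def matrixCoeff (Φ : (H →L[ℂ] H) →ₗ[ℂ] (K →L[ℂ] K)) (z w : K) : (H →L[ℂ] H) →ₗ[ℂ] ℂ where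
  toFun B := ⟪z, Φ B w⟫_ℂ
  map_add' B C := by simp
  map_smul' c B := by simp

theorem matrixCoeff_apply (Φ : (H →L[ℂ] H) →ₗ[ℂ] (K →L[ℂ] K)) (z w : K) (B : H →L[ℂ] H) :
    matrixCoeff Φ z w B = ⟪z, Φ B w⟫_ℂ := rfl

theorem sum_natCast_mul_matrixCoeff_bernstein (Φ : (H →L[ℂ] H) →ₗ[ℂ] (K →L[ℂ] K)) (z w : K)
    (a : H →L[ℂ] H) (n : ℕ) (c : ℕ → ℕ) :
    ∑ k ∈ Finset.range (n + 1),
        (c k : ℂ) * matrixCoeff Φ z w (Polynomial.aeval a (bernsteinPolynomial ℝ n k)) =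
      matrixCoeff Φ z w (Polynomial.aeval a
        (∑ k ∈ Finset.range (n + 1), c k • bernsteinPolynomial ℝ n k)) := by
  rw [map_sum, map_sum]
  refine Finset.sum_congr rfl fun k _ => ?_
  rw [map_nsmul, map_nsmul, nsmul_eq_mul]

/-- Kadison's inequality for a contraction `0 ≤ a ≤ 1`, in the form that the matrix with rows
`Φ 1, Φ a` and `Φ a, Φ (a * a)` is positive. -/
theorem kadison_of_unitInterval [CompleteSpace H] (Φ : (H →L[ℂ] H) →ₗ[ℂ] (K →L[ℂ] K))
    (hΦ : ∀ B : H →L[ℂ] H, B.IsPositive → (Φ B).IsPositive) {a : H →L[ℂ] H}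
    (h0 : 0 ≤ a) (h1 : a ≤ 1) (x y : K) :
    0 ≤ ⟪x, Φ 1 x⟫_ℂ + (⟪x, Φ a y⟫_ℂ + ⟪y, Φ a x⟫_ℂ) + ⟪y, Φ (a * a) y⟫_ℂ := by
  set F := ⟪x, Φ 1 x⟫_ℂ + (⟪x, Φ a y⟫_ℂ + ⟪y, Φ a x⟫_ℂ) + ⟪y, Φ (a * a) y⟫_ℂ with hF
  set c := ⟪y, Φ (a - a * a) y⟫_ℂ with hc
  -- The second Bernstein moment at the nodes `k / N` is `a² + (a - a²) / N`; this is the source of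
  -- the error `c / N`.
  have key : ∀ n : ℕ, 0 ≤ F + (1 / ((n : ℂ) + 1)) * c := by
    intro n
    obtain ⟨N, hN⟩ : ∃ N, N = n + 1 := ⟨_, rfl⟩
    have hN0 : (N : ℂ) ≠ 0 := by rw [hN]; exact_mod_cast n.succ_ne_zero
    have hNe : (N : ℂ) = n + 1 := by rw [hN]; push_cast; rfl
    let q : ℕ → (H →L[ℂ] H) := fun k => Polynomial.aeval a (bernsteinPolynomial ℝ N k)
    have hq : ∀ k, (q k).IsPositive := fun k =>
      aeval_isPositive_of_nonneg_on_unitInterval h0 h1 _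
        fun t ht => bernsteinPolynomial_eval_nonneg N k ht
    -- The natural test vector is `x + (k / N) y`, scaled here by `N`.
    have hpos : 0 ≤ ∑ k ∈ Finset.range (N + 1),
        ⟪(N : ℂ) • x + (k : ℂ) • y, Φ (q k) ((N : ℂ) • x + (k : ℂ) • y)⟫_ℂ :=
      Finset.sum_nonneg fun k _ => (hΦ _ (hq k)).inner_nonneg_right _
    have hexp : ∀ k : ℕ, ⟪(N : ℂ) • x + (k : ℂ) • y, Φ (q k) ((N : ℂ) • x + (k : ℂ) • y)⟫_ℂ =
        (N : ℂ) ^ 2 * matrixCoeff Φ x x (q k) +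
        (N : ℂ) * ((k : ℂ) * matrixCoeff Φ x y (q k)) +
        (N : ℂ) * ((k : ℂ) * matrixCoeff Φ y x (q k)) +
        ((k * (k - 1) : ℕ) : ℂ) * matrixCoeff Φ y y (q k) +
        (k : ℂ) * matrixCoeff Φ y y (q k) := by
      intro k
      -- The Bernstein identities give the factorial moment `k (k - 1)`, so `k²` is split
      -- accordingly.
      have hk : ((k * (k - 1) : ℕ) : ℂ) + k = (k : ℂ) ^ 2 := by
        rcases k with _ | k
        · simp
        · push_cast [Nat.add_sub_cancel]; ring
      rw [add_assoc _ (((k * (k - 1) : ℕ) : ℂ) * _), ← add_mul, hk]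
      simp only [map_add, map_smul, inner_add_left, inner_add_right, inner_smul_left,
        inner_smul_right, Complex.conj_natCast, matrixCoeff_apply]
      ring
    have hsum : ∑ k ∈ Finset.range (N + 1),
        ⟪(N : ℂ) • x + (k : ℂ) • y, Φ (q k) ((N : ℂ) • x + (k : ℂ) • y)⟫_ℂ =
        (N : ℂ) ^ 2 * (F + (1 / (N : ℂ)) * c) := by
      have e1 := bernsteinPolynomial.sum ℝ N
      have e2 := bernsteinPolynomial.sum_smul ℝ N
      have e3 := bernsteinPolynomial.sum_mul_smul ℝ N
      have hNN : ((N * (N - 1) : ℕ) : ℂ) = (N : ℂ) ^ 2 - N := by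
        rw [hN]; push_cast [Nat.add_sub_cancel]; ring
      simp only [hexp, Finset.sum_add_distrib, ← Finset.mul_sum]
      simp only [q]
      rw [← map_sum, ← map_sum,
        sum_natCast_mul_matrixCoeff_bernstein Φ x y a N (fun k => k),
        sum_natCast_mul_matrixCoeff_bernstein Φ y x a N (fun k => k),
        sum_natCast_mul_matrixCoeff_bernstein Φ y y a N (fun k => k * (k - 1)),
        sum_natCast_mul_matrixCoeff_bernstein Φ y y a N (fun k => k), e1, e2, e3]
      simp only [map_nsmul, map_one, map_pow, Polynomial.aeval_X]
      simp only [nsmul_eq_mul, hNN]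
      simp only [hF, hc, map_sub, matrixCoeff_apply, sub_apply, inner_sub_right, pow_two]
      field_simp
      ring
    rw [hsum, hNe] at hpos
    rw [← hNe] at hpos ⊢
    have h2 : (0 : ℂ) ≤ ((N : ℂ) ^ 2)⁻¹ :=
      inv_nonneg.2 (pow_nonneg (Nat.cast_nonneg N) 2)
    simpa only [inv_mul_cancel_left₀ (pow_ne_zero 2 hN0)] using mul_nonneg h2 hpos
  have hlim : Filter.Tendsto (fun n : ℕ => F + (1 / ((n : ℂ) + 1)) * c) Filter.atTop
      (nhds (F + 0 * c)) :=
    tendsto_const_nhds.add ((tendsto_one_div_add_atTop_nhds_zero_nat (𝕜 := ℂ)).mul_const c)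
  rw [zero_mul, add_zero] at hlim
  exact ge_of_tendsto' hlim key

/-- Kadison's inequality for a selfadjoint `S`, in the form that the matrix with rows
`Φ 1, Φ S` and `Φ S, Φ (S * S)` is positive. -/
theorem kadison_of_isSelfAdjoint [CompleteSpace H] (Φ : (H →L[ℂ] H) →ₗ[ℂ] (K →L[ℂ] K))
    (hΦ : ∀ B : H →L[ℂ] H, B.IsPositive → (Φ B).IsPositive) {S : H →L[ℂ] H}
    (hS : IsSelfAdjoint S) (x y : K) :
    0 ≤ ⟪x, Φ 1 x⟫_ℂ + (⟪x, Φ S y⟫_ℂ + ⟪y, Φ S x⟫_ℂ) + ⟪y, Φ (S * S) y⟫_ℂ := by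
  -- The `+ 1` keeps `M` invertible when `S = 0`.
  obtain ⟨M, hM, hM'⟩ : ∃ M : ℝ, 0 < M ∧ ‖S‖ ≤ M := ⟨‖S‖ + 1, by positivity, by simp⟩
  have hle : algebraMap ℝ (H →L[ℂ] H) ‖S‖ ≤ algebraMap ℝ (H →L[ℂ] H) M := algebraMap_mono _ hM'
  have hu : S ≤ M • 1 := by
    rw [← Algebra.algebraMap_eq_smul_one]; exact hS.le_algebraMap_norm_self.trans hle
  have hl : -(M • 1) ≤ S := by
    rw [← Algebra.algebraMap_eq_smul_one]
    exact (neg_le_neg hle).trans hS.neg_algebraMap_norm_le_self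
  set a : H →L[ℂ] H := (2 * M)⁻¹ • (S + M • 1) with ha
  have h2M : 0 ≤ (2 * M)⁻¹ := by positivity
  have h0 : 0 ≤ a := smul_nonneg h2M (by rw [← sub_neg_eq_add]; exact sub_nonneg.2 hl)
  have h1 : a ≤ 1 := by
    have : (1 : H →L[ℂ] H) - a = (2 * M)⁻¹ • (M • 1 - S) := by
      rw [ha]
      match_scalars
      · field_simp
        ring
      · field_simp
    rw [← sub_nonneg, this]
    exact smul_nonneg h2M (sub_nonneg.2 hu)
  have hSa : S = (2 * M : ℂ) • a - (M : ℂ) • 1 := by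
    have : S = (2 * M) • a - M • (1 : H →L[ℂ] H) := by
      rw [ha, smul_inv_smul₀ (by positivity), add_sub_cancel_right]
    ext z
    have := congrArg (fun f : H →L[ℂ] H => f z) this
    simpa [← Complex.coe_smul] using this
  have hSS : S * S = (4 * M ^ 2 : ℂ) • (a * a) - (4 * M ^ 2 : ℂ) • a + (M ^ 2 : ℂ) • 1 := by
    rw [hSa]
    simp only [sub_mul, mul_sub, smul_mul_assoc, mul_smul_comm, one_mul, mul_one]
    match_scalars <;> ring
  -- Since `S = 2M a - M`, formally `x + S y = (x - M y) + a (2M y)`.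
  have h := kadison_of_unitInterval Φ hΦ h0 h1 (x - (M : ℂ) • y) ((2 * M : ℂ) • y)
  rw [hSS]
  convert h using 1
  rw [hSa]
  simp only [map_add, map_sub, map_smul, add_apply, sub_apply, smul_apply, inner_add_right,
    inner_sub_left, inner_sub_right, inner_smul_left, inner_smul_right, map_mul, map_ofNat,
    Complex.conj_ofReal]
  ring

/-! ### Quadratic forms of arrow matrices -/

/-- The quadratic form of a matrix with diagonal `T, …, T, R`, with the entries `S i` in the row
and in the column of `R`, and with zeros elsewhere. -/
noncomputable def arrowForm {ι : Type*} [Fintype ι] (T R : H →L[ℂ] H) (S : ι → (H →L[ℂ] H)) (x : ι → H)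
    (y : H) : ℂ :=
  ∑ i, (⟪x i, T (x i)⟫_ℂ + (⟪x i, S i y⟫_ℂ + ⟪y, S i (x i)⟫_ℂ)) + ⟪y, R y⟫_ℂ

theorem arrowForm_add_smul {ι : Type*} [Fintype ι] (T R B : H →L[ℂ] H)
    (S : ι → (H →L[ℂ] H)) (c : ℂ) (x : ι → H) (y : H) :
    arrowForm (T + c • B) R S x y = arrowForm T R S x y + c * ∑ i, ⟪x i, B (x i)⟫_ℂ := by
  simp only [arrowForm, add_apply, smul_apply, inner_add_right, inner_smul_right,
    Finset.sum_add_distrib, Finset.mul_sum]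
  ring

theorem arrowForm_single {ι : Type*} [Fintype ι] [DecidableEq ι] (T R : H →L[ℂ] H)
    (S : ι → (H →L[ℂ] H)) (i : ι) (v y : H) :
    arrowForm T R S (Pi.single i v) y =
      ⟪v, T v⟫_ℂ + (⟪v, S i y⟫_ℂ + ⟪y, S i v⟫_ℂ) + ⟪y, R y⟫_ℂ := by
  rw [arrowForm, Finset.sum_eq_single i]
  · simp
  · intro j _ hj
    simp [hj]
  · simp

/-- In `ComplexOrder`, `0 ≤ z` includes that `z` is real, and over `ℂ` a real quadratic form makes
the operator symmetric. -/
theorem isPositive_of_forall_inner_nonneg {T : H →L[ℂ] H} (h : ∀ x, 0 ≤ ⟪x, T x⟫_ℂ) :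
    T.IsPositive := by
  refine (ContinuousLinearMap.isPositive_iff_complex T).2 fun x => ?_
  have hx := h x
  rw [← inner_conj_symm, ← RCLike.star_def, star_nonneg_iff] at hx
  exact ⟨(Complex.eq_re_of_ofReal_le hx).symm, (Complex.nonneg_iff.1 hx).1⟩

/-- Positivity of the Schur complement of `T = C * C` in an arrow matrix with entries
`S i = C * X i * C`. -/
theorem isPositive_schurComplement {ι : Type*} [Fintype ι] [CompleteSpace H]
    {C D R : H →L[ℂ] H} {X : ι → (H →L[ℂ] H)} (hC : IsSelfAdjoint C)
    (hCD : C * D = 1) (hX : ∀ i, IsSelfAdjoint (X i))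
    (h : ∀ x y, 0 ≤ arrowForm (C * C) R (fun i => C * X i * C) x y) :
    (R - ∑ i, C * (X i * X i) * C).IsPositive := by
  refine isPositive_of_forall_inner_nonneg fun y => ?_
  have hCs := (ContinuousLinearMap.isSelfAdjoint_iff_isSymmetric.1 hC)
  have hC' : ∀ u v, ⟪u, C v⟫_ℂ = ⟪C u, v⟫_ℂ := fun u v => (hCs u v).symm
  have hX' : ∀ i u v, ⟪u, X i v⟫_ℂ = ⟪X i u, v⟫_ℂ := fun i u v =>
    (ContinuousLinearMap.isSelfAdjoint_iff_isSymmetric.1 (hX i) u v).symm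
  have hCD' : ∀ v, C (D v) = v := fun v => congrArg (fun f : H →L[ℂ] H => f v) hCD
  -- This choice solves `C x_i = -X_i C y`, the minimum of the form over `x`.
  have key := h (fun i => -D (X i (C y))) y
  convert key using 1
  simp only [arrowForm, sub_apply, _root_.sum_apply, mul_apply_eq_comp, hC', hX', map_neg,
    hCD', inner_sub_right, inner_sum, inner_neg_left, inner_neg_right, neg_neg]
  rw [sub_eq_add_neg, add_comm, ← Finset.sum_neg_distrib]
  congr 1
  refine Finset.sum_congr rfl fun i _ => ?_
  ring

theorem isPositive_of_arrowForm_nonneg {ι : Type*} [Fintype ι] {T R : H →L[ℂ] H}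
    {S : ι → (H →L[ℂ] H)} (h : ∀ x y, 0 ≤ arrowForm T R S x y) (i : ι) : T.IsPositive := by
  classical
  refine isPositive_of_forall_inner_nonneg fun v => ?_
  have := h (Pi.single i v) 0
  rwa [arrowForm_single, map_zero, map_zero, inner_zero_right, inner_zero_left, inner_zero_left,
    add_zero, add_zero, add_zero] at this

/-- The same `S i` stands in the row and in the column, so the reality of the form forces symmetry,
by polarization with `y` and `I • y`. -/
theorem isSelfAdjoint_of_arrowForm_nonneg {ι : Type*} [Fintype ι] [CompleteSpace H]
    {T R : H →L[ℂ] H} {S : ι → (H →L[ℂ] H)} (h : ∀ x y, 0 ≤ arrowForm T R S x y) (i : ι) :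
    IsSelfAdjoint (S i) := by
  classical
  have hform : ∀ v y, 0 ≤ ⟪v, T v⟫_ℂ + (⟪v, S i y⟫_ℂ + ⟪y, S i v⟫_ℂ) + ⟪y, R y⟫_ℂ := fun v y => by
    simpa only [arrowForm_single] using h (Pi.single i v) y
  have him : ∀ v y, (⟪v, S i y⟫_ℂ + ⟪y, S i v⟫_ℂ).im = 0 := fun v y => by
    have h1 := (Complex.nonneg_iff.1 (hform v y)).2
    have h2 := (Complex.nonneg_iff.1 (hform v 0)).2
    have h3 := (Complex.nonneg_iff.1 (hform 0 y)).2
    simp only [map_zero, inner_zero_left, inner_zero_right, Complex.add_im, Complex.zero_im]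
      at h1 h2 h3 ⊢
    linarith
  refine ContinuousLinearMap.isSelfAdjoint_iff_isSymmetric.2 fun v y => ?_
  change ⟪S i v, y⟫_ℂ = ⟪v, S i y⟫_ℂ
  rw [← inner_conj_symm]
  have h1 := him v y
  have h2 := him v (Complex.I • y)
  simp only [map_smul, inner_smul_left, inner_smul_right, Complex.conj_I, Complex.add_im,
    Complex.mul_im, Complex.neg_im, Complex.neg_re, Complex.I_re, Complex.I_im] at h1 h2
  apply Complex.ext
  · rw [Complex.conj_re]; linarith
  · rw [Complex.conj_im]; linarith

theorem arrowForm_map_nonneg_of_eq_mul_self {ι : Type*} [Fintype ι] [CompleteSpace H]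
    (Φ : (H →L[ℂ] H) →ₗ[ℂ] (K →L[ℂ] K))
    (hΦ : ∀ B : H →L[ℂ] H, B.IsPositive → (Φ B).IsPositive)
    {C R : H →L[ℂ] H} (hCu : IsUnit C) (hC : IsSelfAdjoint C) {S : ι → (H →L[ℂ] H)}
    (hS : ∀ i, IsSelfAdjoint (S i)) (h : ∀ x y, 0 ≤ arrowForm (C * C) R S x y) (x : ι → K) (y : K) :
    0 ≤ arrowForm (Φ (C * C)) (Φ R) (fun i => Φ (S i)) x y := by
  obtain ⟨D, hCD, hDC⟩ := isUnit_iff_exists.1 hCu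
  have hD : IsSelfAdjoint D := by
    have h1 : star D * C = 1 := by simpa [hC.star_eq] using congrArg star hCD
    exact left_inv_eq_right_inv h1 hCD
  obtain ⟨X, rfl⟩ : ∃ X : ι → (H →L[ℂ] H), S = fun i => C * X i * C := by
    refine ⟨fun i => D * S i * D, funext fun i => ?_⟩
    rw [← mul_assoc, ← mul_assoc, hCD, one_mul, mul_assoc, hDC, mul_one]
  have hX : ∀ i, IsSelfAdjoint (X i) := fun i => by
    have h1 := (hS i).conjugate_self hD
    rwa [← mul_assoc, ← mul_assoc, hDC, one_mul, mul_assoc, hCD, mul_one] at h1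
  let Ψ : (H →L[ℂ] H) →ₗ[ℂ] (K →L[ℂ] K) :=
    Φ ∘ₗ LinearMap.mulRight ℂ C ∘ₗ LinearMap.mulLeft ℂ C
  have hΨa : ∀ B, Ψ B = Φ (C * B * C) := fun B => rfl
  have hΨ : ∀ B : H →L[ℂ] H, B.IsPositive → (Ψ B).IsPositive := fun B hB => by
    refine hΦ _ ?_
    rw [← ContinuousLinearMap.nonneg_iff_isPositive] at hB ⊢
    exact hC.conjugate_nonneg hB
  have hk : ∀ i, 0 ≤ ⟪x i, Φ (C * C) (x i)⟫_ℂ +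
      (⟪x i, Φ (C * X i * C) y⟫_ℂ + ⟪y, Φ (C * X i * C) (x i)⟫_ℂ) +
      ⟪y, Φ (C * (X i * X i) * C) y⟫_ℂ := fun i => by
    simpa only [hΨa, mul_one] using kadison_of_isSelfAdjoint Ψ hΨ (hX i) (x i) y
  have hschur := (hΦ _ (isPositive_schurComplement hC hCD hX h)).inner_nonneg_right y
  -- The terms `⟪y, Φ (C X_i² C) y⟫` cancel against the Schur complement.
  have := add_nonneg (Finset.sum_nonneg fun i (_ : i ∈ Finset.univ) => hk i) hschur
  convert this using 1
  simp only [arrowForm, map_sub, map_sum, sub_apply, _root_.sum_apply, inner_sub_right,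
    inner_sum, Finset.sum_add_distrib]
  ring

/-- A positive map preserves positivity of the quadratic form of an arrow matrix. -/
theorem arrowForm_map_nonneg {ι : Type*} [Fintype ι] [CompleteSpace H]
    (Φ : (H →L[ℂ] H) →ₗ[ℂ] (K →L[ℂ] K))
    (hΦ : ∀ B : H →L[ℂ] H, B.IsPositive → (Φ B).IsPositive)
    {T R : H →L[ℂ] H} {S : ι → (H →L[ℂ] H)} (h : ∀ x y, 0 ≤ arrowForm T R S x y)
    (x : ι → K) (y : K) : 0 ≤ arrowForm (Φ T) (Φ R) (fun i => Φ (S i)) x y := by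
  -- Without an index, `T` is absent from the form and need not be positive.
  rcases isEmpty_or_nonempty ι with hι | ⟨⟨i₀⟩⟩
  · have hR : R.IsPositive := isPositive_of_forall_inner_nonneg fun v => by
      simpa [arrowForm] using h (fun i => hι.elim i) v
    simpa [arrowForm] using (hΦ R hR).inner_nonneg_right y
  have hT := isPositive_of_arrowForm_nonneg h i₀
  have hS := isSelfAdjoint_of_arrowForm_nonneg h
  -- Adding `1 / (n + 1)` to `T` makes it invertible and keeps the form nonnegative; the extra term
  -- vanishes in the limit.
  have key : ∀ n : ℕ, 0 ≤ arrowForm (Φ T) (Φ R) (fun i => Φ (S i)) x y +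
      (1 / ((n : ℂ) + 1)) * ∑ i, ⟪x i, Φ 1 (x i)⟫_ℂ := by
    intro n
    have hε : (0 : ℝ) < 1 / ((n : ℝ) + 1) := Nat.one_div_pos_of_nat
    have hεc : (0 : ℂ) ≤ 1 / ((n : ℂ) + 1) := by
      have := Complex.zero_le_real.2 hε.le
      push_cast at this
      exact this
    have hpos : IsStrictlyPositive (T + (1 / ((n : ℂ) + 1)) • (1 : H →L[ℂ] H)) := by
      refine IsStrictlyPositive.nonneg_add
        ((ContinuousLinearMap.nonneg_iff_isPositive T).2 hT) ?_
      rw [IsStrictlyPositive.iff_of_unital]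
      refine ⟨smul_nonneg hεc zero_le_one, ?_⟩
      rw [← Algebra.algebraMap_eq_smul_one]
      exact (IsUnit.mk0 _ (one_div_ne_zero (Nat.cast_add_one_ne_zero n))).map _
    obtain ⟨C, hCu, hC, hCC⟩ := CStarAlgebra.isStrictlyPositive_iff_exists_isUnit_and_isSelfAdjoint_and_eq_mul_self.1 hpos
    have := arrowForm_map_nonneg_of_eq_mul_self Φ hΦ (R := R) hCu hC hS (fun u v => by
      rw [← hCC, arrowForm_add_smul]
      exact add_nonneg (h u v) (mul_nonneg hεc (Finset.sum_nonneg fun i _ => by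
        exact ContinuousLinearMap.isPositive_one.inner_nonneg_right (u i)))) x y
    rw [← hCC, map_add, map_smul, arrowForm_add_smul] at this
    exact this
  have hlim : Filter.Tendsto (fun n : ℕ => arrowForm (Φ T) (Φ R) (fun i => Φ (S i)) x y +
      (1 / ((n : ℂ) + 1)) * ∑ i, ⟪x i, Φ 1 (x i)⟫_ℂ) Filter.atTop
      (nhds (arrowForm (Φ T) (Φ R) (fun i => Φ (S i)) x y + 0 * ∑ i, ⟪x i, Φ 1 (x i)⟫_ℂ)) :=
    tendsto_const_nhds.add ((tendsto_one_div_add_atTop_nhds_zero_nat (𝕜 := ℂ)).mul_const _)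
  rw [zero_mul, add_zero] at hlim
  exact ge_of_tendsto' hlim key

/-! ### From block matrices to quadratic forms -/

theorem inner_blockOperator {m : ℕ} (A : Matrix (Fin m) (Fin m) (H →L[ℂ] H))
    (x : PiLp 2 (fun _ : Fin m => H)) :
    ⟪x, blockOperator A x⟫_ℂ = ∑ i, ∑ j, ⟪x i, A i j (x j)⟫_ℂ := by
  simp only [PiLp.inner_apply, blockOperator_apply, inner_sum]

theorem blockPositive_iff {m : ℕ} (A : Matrix (Fin m) (Fin m) (H →L[ℂ] H)) :
    BlockPositive A ↔ ∀ x : Fin m → H, 0 ≤ ∑ i, ∑ j, ⟪x i, A i j (x j)⟫_ℂ := by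
  refine ⟨fun h x => ?_, fun h => isPositive_of_forall_inner_nonneg fun x => ?_⟩
  · simpa only [inner_blockOperator] using h.inner_nonneg_right (WithLp.toLp 2 x)
  · rw [inner_blockOperator]
    exact h fun i => x i

theorem sum_inner_ite_apply {ι : Type*} [Fintype ι] [DecidableEq ι] (B : H →L[ℂ] H) (i : ι) (v : H)
    (w : ι → H) :
    ∑ j, ⟪v, (if i = j then B else 0) (w j)⟫_ℂ = ⟪v, B (w i)⟫_ℂ := by
  rw [Finset.sum_eq_single i]
  · simp
  · intro j _ hj
    simp [hj.symm]
  · simp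

theorem blockPositive_arrowLast_iff {n : ℕ} (T R : H →L[ℂ] H) (S : Fin n → (H →L[ℂ] H)) :
    BlockPositive (arrowLast T R S) ↔ ∀ x y, 0 ≤ arrowForm T R S x y := by
  have hsum : ∀ z : Fin (n + 1) → H, ∑ i, ∑ j, ⟪z i, arrowLast T R S i j (z j)⟫_ℂ =
      arrowForm T R S (fun i => z i.castSucc) (z (Fin.last n)) := fun z => by
    simp only [Fin.sum_univ_castSucc, arrowLast, Matrix.of_apply, Fin.lastCases_castSucc,
      Fin.lastCases_last, arrowForm,
      sum_inner_ite_apply, Finset.sum_add_distrib]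
    ring
  rw [blockPositive_iff]
  refine ⟨fun h x y => ?_, fun h z => ?_⟩
  · simpa only [hsum, Fin.snoc_castSucc, Fin.snoc_last] using
      h (Fin.snoc (α := fun _ => H) x y)
  · rw [hsum]
    exact h _ _

/-- Moving the first coordinate to the end exchanges `T` and `R`, so one result on `arrowForm`
serves both shapes. -/
theorem blockPositive_arrowFirst_iff {n : ℕ} (T R : H →L[ℂ] H) (S : Fin n → (H →L[ℂ] H)) :
    BlockPositive (arrowFirst T R S) ↔ ∀ x y, 0 ≤ arrowForm R T S x y := by
  have hsum : ∀ z : Fin (n + 1) → H, ∑ i, ∑ j, ⟪z i, arrowFirst T R S i j (z j)⟫_ℂ =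
      arrowForm R T S (fun i => z i.succ) (z 0) := fun z => by
    simp only [Fin.sum_univ_succ, arrowFirst, Matrix.of_apply, Fin.cases_zero, Fin.cases_succ,
      arrowForm, sum_inner_ite_apply, Finset.sum_add_distrib]
    ring
  rw [blockPositive_iff]
  refine ⟨fun h x y => ?_, fun h z => ?_⟩
  · simpa only [hsum, Fin.cons_succ, Fin.cons_zero] using
      h (Fin.cons (α := fun _ => H) y x)
  · rw [hsum]
    exact h _ _

theorem ampliation_arrowLast {n : ℕ} (Φ : (H →L[ℂ] H) →ₗ[ℂ] (K →L[ℂ] K)) (T R : H →L[ℂ] H)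
    (S : Fin n → (H →L[ℂ] H)) :
    ampliation (n + 1) Φ (arrowLast T R S) = arrowLast (Φ T) (Φ R) (fun i => Φ (S i)) := by
  ext1 i j
  refine Fin.lastCases ?_ (fun i' => ?_) i <;> refine Fin.lastCases ?_ (fun j' => ?_) j <;>
    simp [ampliation, arrowLast, apply_ite Φ]

theorem ampliation_arrowFirst {n : ℕ} (Φ : (H →L[ℂ] H) →ₗ[ℂ] (K →L[ℂ] K)) (T R : H →L[ℂ] H)
    (S : Fin n → (H →L[ℂ] H)) :
    ampliation (n + 1) Φ (arrowFirst T R S) = arrowFirst (Φ T) (Φ R) (fun i => Φ (S i)) := by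
  ext1 i j
  refine Fin.cases ?_ (fun i' => ?_) i <;> refine Fin.cases ?_ (fun j' => ?_) j <;>
    simp [ampliation, arrowFirst, apply_ite Φ]

end ArrowMatrices

theorem theorem9 {H : Type*} {K : Type*}
    [NormedAddCommGroup H] [InnerProductSpace ℂ H] [CompleteSpace H]
    [NormedAddCommGroup K] [InnerProductSpace ℂ K] [CompleteSpace K]
    (Φ : (H →L[ℂ] H) →ₗ[ℂ] (K →L[ℂ] K))
    (hΦ : ∀ B : H →L[ℂ] H, B.IsPositive → (Φ B).IsPositive)
    (n : ℕ) (T R : H →L[ℂ] H) (S : Fin n → (H →L[ℂ] H)) :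
    (BlockPositive (arrowLast T R S) →
      BlockPositive (ampliation (n + 1) Φ (arrowLast T R S))) ∧
    (BlockPositive (arrowFirst T R S) →
      BlockPositive (ampliation (n + 1) Φ (arrowFirst T R S))) := by
  rw [ampliation_arrowLast, ampliation_arrowFirst]
  simp only [blockPositive_arrowLast_iff, blockPositive_arrowFirst_iff]
  exact ⟨arrowForm_map_nonneg Φ hΦ, arrowForm_map_nonneg Φ hΦ⟩
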